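/- Let $R$ be a commutative unital ring and let $I\subseteq R$ be a regular ideal, i.e. an ideal generated by a finite sequence $u_1,\dots,u_m$ ($m \ge 0$) or an infinite sequence $u_1,u_2,\dots$ of elements of $R$ such that each $u_k$ is a non-zero-divisor on $R/(u_1,\dots,u_{k-1})$. Then for every integer $s\geq 1$, $\operatorname{Tor}^R_*(R/I,R/I^s)$ is a free (graded) $R/I$-module: for every $n\geq 0$, $\operatorname{Tor}^R_n(R/I,R/I^s)$, with the $R/I$-module structure induced by functoriality from multiplication on the first variable $R/I$, is a free $R/I$-module. -/

import Mathlib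

open CategoryTheory

universe u

/-- An ideal `I` of a commutative ring `R` is *regular* if it is generated by a finite sequence
`u_1, …, u_n` or an infinite sequence `u_1, u_2, …` of elements of `R` such that every `u_k` is a
non-zero-divisor on `R / (u_1, …, u_{k-1})`.  Properness of `I` is not demanded, so both the
convention that asks for `R / I ≠ 0` and the one that does not are covered. -/
def IsRegularIdeal {R : Type u} [CommRing R] (I : Ideal R) : Prop :=
  (∃ rs : List R, RingTheory.Sequence.IsWeaklyRegular R rs ∧ I = Ideal.ofList rs) ∨
  (∃ x : ℕ → R,
    (∀ n : ℕ, RingTheory.Sequence.IsWeaklyRegular R ((List.range n).map x)) ∧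
      I = Ideal.span (Set.range x))

section Tor

variable (R : Type u) [CommRing R] (A : Type u) [CommRing A] [Algebra R A]
  (M : Type u) [AddCommGroup M] [Module R M]

/-- `Tor_n^R(A, M)` for an `R`-algebra `A` and an `R`-module `M`, as Mathlib's `Tor` in the
category of `R`-modules: the `n`-th left derived functor of `A ⊗[R] -` at `M`. -/
noncomputable def AlgTorObj (n : ℕ) : ModuleCat.{u} R :=
  ((Tor (ModuleCat.{u} R) n).obj (ModuleCat.of R A)).obj (ModuleCat.of R M)

/-- The endomorphism of `Tor_n^R(A, M)` induced, by functoriality in the first variable, by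
multiplication by `a` on `A`. -/
noncomputable def algTorMul (n : ℕ) (a : A) : AlgTorObj R A M n ⟶ AlgTorObj R A M n :=
  ((Tor (ModuleCat.{u} R) n).map (ModuleCat.ofHom (LinearMap.mulLeft R a))).app
    (ModuleCat.of R M)

theorem algTorMul_one (n : ℕ) : algTorMul R A M n 1 = 𝟙 _ := by
  have h : ModuleCat.ofHom (LinearMap.mulLeft R (1 : A)) = 𝟙 (ModuleCat.of R A) := by
    ext; simp
  unfold algTorMul
  rw [h, CategoryTheory.Functor.map_id]
  rfl

theorem algTorMul_mul (n : ℕ) (a b : A) :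
    algTorMul R A M n (a * b) = algTorMul R A M n b ≫ algTorMul R A M n a := by
  have h : ModuleCat.ofHom (LinearMap.mulLeft R (a * b)) =
      ModuleCat.ofHom (LinearMap.mulLeft R b) ≫ ModuleCat.ofHom (LinearMap.mulLeft R a) := by
    ext; simp
  unfold algTorMul
  rw [h, CategoryTheory.Functor.map_comp]
  rfl

/-- `Tor_n` is additive in its first variable. -/
theorem tor_map_add_app {X Y : ModuleCat.{u} R} (f g : X ⟶ Y) (Z : ModuleCat.{u} R) (n : ℕ) :
    ((Tor (ModuleCat.{u} R) n).map (f + g)).app Z =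
      ((Tor (ModuleCat.{u} R) n).map f).app Z + ((Tor (ModuleCat.{u} R) n).map g).app Z := by
  let P := projectiveResolution Z
  have key := fun h : X ⟶ Y =>
    P.leftDerived_app_eq ((MonoidalCategory.tensoringLeft (ModuleCat.{u} R)).map h) n
  simp only [Tor_map]
  rw [key, key, key]
  have e : (NatTrans.mapHomologicalComplex
        ((MonoidalCategory.tensoringLeft (ModuleCat.{u} R)).map (f + g))
        (ComplexShape.down ℕ)).app P.complex =
      (NatTrans.mapHomologicalComplex
        ((MonoidalCategory.tensoringLeft (ModuleCat.{u} R)).map f)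
        (ComplexShape.down ℕ)).app P.complex +
      (NatTrans.mapHomologicalComplex
        ((MonoidalCategory.tensoringLeft (ModuleCat.{u} R)).map g)
        (ComplexShape.down ℕ)).app P.complex := by
    ext1 i
    simp
    rfl
  rw [e, Functor.map_add, Preadditive.add_comp, Preadditive.comp_add]
  rfl

theorem algTorMul_add (n : ℕ) (a b : A) :
    algTorMul R A M n (a + b) = algTorMul R A M n a + algTorMul R A M n b := by
  have h : ModuleCat.ofHom (LinearMap.mulLeft R (a + b)) =
      ModuleCat.ofHom (LinearMap.mulLeft R a) + ModuleCat.ofHom (LinearMap.mulLeft R b) := by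
    ext x; exact add_mul a b x
  unfold algTorMul
  rw [h, tor_map_add_app]
  rfl

/-- The underlying type of `Tor_n^R(A, M)`. -/
def AlgTor (n : ℕ) : Type u := AlgTorObj R A M n

noncomputable instance (n : ℕ) : AddCommGroup (AlgTor R A M n) :=
  inferInstanceAs (AddCommGroup (AlgTorObj R A M n))

/-- The natural `A`-module structure on `Tor_n^R(A, M)`: `a ∈ A` acts by the map induced on
`Tor_n` by multiplication by `a` on the first variable. -/
noncomputable instance (n : ℕ) : Module A (AlgTor R A M n) where
  smul a x := (algTorMul R A M n a).hom x
  one_smul x := congrArg (fun φ : AlgTorObj R A M n ⟶ AlgTorObj R A M n => φ.hom x)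
    (algTorMul_one R A M n)
  mul_smul a b x := congrArg (fun φ : AlgTorObj R A M n ⟶ AlgTorObj R A M n => φ.hom x)
    (algTorMul_mul R A M n a b)
  smul_zero a := map_zero (algTorMul R A M n a).hom
  smul_add a x y := map_add (algTorMul R A M n a).hom x y
  add_smul a b x := congrArg (fun φ : AlgTorObj R A M n ⟶ AlgTorObj R A M n => φ.hom x)
    (algTorMul_add R A M n a b)
  zero_smul x := by
    have h : algTorMul R A M n 0 = 0 := by
      have := algTorMul_add R A M n 0 0
      rwa [add_zero, left_eq_add] at this
    exact congrArg (fun φ : AlgTorObj R A M n ⟶ AlgTorObj R A M n => φ.hom x) h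

end Tor

/-! Write J_k = (u_0, …, u_{k-1}). The plan is to build a free resolution of R/I^s whose
differential has image in I times the target. Tensoring with R/I then kills every differential, so
Tor_n is R/I ⊗ P_n, which is free.

The resolution is an iterated mapping cone over the short exact sequences 0 → J_k^{s+1} → J_k^{s+1}
⊕ J_{k+1}^s → J_{k+1}^{s+1} → 0, with maps c ↦ (-u_k c, c) and (a, b) ↦ a + u_k b. Basis words
record the cone summands: `mul k` is multiplication by u_k out of the resolution of J_{k+1}^s, and
`tau k` is the shifted copy of the resolution of J_k^{s+1}. A word in degree n for the s-th power
thus has s letters `mul` and n letters `tau`. The map `phi` lifts the inclusion J^{s+1} ⊆ J^s; since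
both `phi` and multiplication by u_k have coefficients in the ideal, the cone stays minimal
(`d_mem_smul`).

Exactness of the sequence needs u_k to be a non-zero-divisor modulo every power of J_k, which
minimality and exactness of the previous stage supply (`IsExact.mem_pow_of_mul_mem`). `IsExact.succ`
is the cone argument. Infinite sequences need no separate construction: every element and relation
lives at a finite stage. -/

/-- Words in two families of letters `mul k` and `tau k`, `k : ℕ`, ending in `pt`. -/
inductive TorWord : Type
  | pt : TorWord
  | mul (k : ℕ) (w : TorWord) : TorWord
  | tau (k : ℕ) (w : TorWord) : TorWord

namespace TorWord

/-- `Adm k s n w`: the word `w` indexes a basis element in homological degree `n` of the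
resolution of `(u 0, …, u (k - 1)) ^ s`. -/
inductive Adm : ℕ → ℕ → ℕ → TorWord → Prop
  | pt (k : ℕ) : Adm k 0 0 pt
  | mul {j k s n : ℕ} {w : TorWord} (h : j < k) (hw : Adm (j + 1) s n w) : Adm k (s + 1) n (mul j w)
  | tau {j k s n : ℕ} {w : TorWord} (h : j < k) (hw : Adm j (s + 1) n w) :
      Adm k (s + 1) (n + 1) (tau j w)

theorem Adm.mono {k l s n : ℕ} {w : TorWord} (h : Adm k s n w) (hkl : k ≤ l) : Adm l s n w := by
  cases h with
  | pt => exact .pt l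
  | mul h hw => exact .mul (h.trans_le hkl) hw
  | tau h hw => exact .tau (h.trans_le hkl) hw

theorem mul_injective (k : ℕ) : Function.Injective (mul k) := fun _ _ h => by cases h; rfl

theorem tau_injective (k : ℕ) : Function.Injective (tau k) := fun _ _ h => by cases h; rfl

/-! ### The differential, the comparison map, the augmentation, and minimality. -/

section Maps

variable {R : Type u} [CommRing R]

/-- Prefixing words with the letter `mul k`. -/
noncomputable def mulL (k : ℕ) : (TorWord →₀ R) →ₗ[R] (TorWord →₀ R) :=
  Finsupp.lmapDomain R R (mul k)

/-- Prefixing words with the letter `tau k`. -/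
noncomputable def tauL (k : ℕ) : (TorWord →₀ R) →ₗ[R] (TorWord →₀ R) :=
  Finsupp.lmapDomain R R (tau k)

@[simp] theorem mulL_single (k : ℕ) (w : TorWord) (r : R) :
    mulL k (Finsupp.single w r) = Finsupp.single (mul k w) r := by
  simp [mulL]

@[simp] theorem tauL_single (k : ℕ) (w : TorWord) (r : R) :
    tauL k (Finsupp.single w r) = Finsupp.single (tau k w) r := by
  simp [tauL]

/-- Stripping the letter `mul k` from the words beginning with it. -/
noncomputable def mulP (k : ℕ) : (TorWord →₀ R) →ₗ[R] (TorWord →₀ R) :=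
  Finsupp.lcomapDomain (mul k) (mul_injective k)

/-- Stripping the letter `tau k` from the words beginning with it. -/
noncomputable def tauP (k : ℕ) : (TorWord →₀ R) →ₗ[R] (TorWord →₀ R) :=
  Finsupp.lcomapDomain (tau k) (tau_injective k)

@[simp] theorem mulP_apply (k : ℕ) (x : TorWord →₀ R) (w : TorWord) :
    mulP k x w = x (mul k w) := rfl

@[simp] theorem tauP_apply (k : ℕ) (x : TorWord →₀ R) (w : TorWord) :
    tauP k x w = x (tau k w) := rfl

@[simp] theorem mulL_apply_mul (k : ℕ) (x : TorWord →₀ R) (w : TorWord) :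
    mulL k x (mul k w) = x w := Finsupp.mapDomain_apply (mul_injective k) x w

@[simp] theorem tauL_apply_tau (k : ℕ) (x : TorWord →₀ R) (w : TorWord) :
    tauL k x (tau k w) = x w := Finsupp.mapDomain_apply (tau_injective k) x w

@[simp] theorem mulL_apply_tau (k l : ℕ) (x : TorWord →₀ R) (w : TorWord) :
    mulL k x (tau l w) = 0 := Finsupp.mapDomain_of_notMem_range x _ (by rintro ⟨_, h⟩; cases h)

@[simp] theorem tauL_apply_mul (k l : ℕ) (x : TorWord →₀ R) (w : TorWord) :
    tauL k x (mul l w) = 0 := Finsupp.mapDomain_of_notMem_range x _ (by rintro ⟨_, h⟩; cases h)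

@[simp] theorem mulL_apply_pt (k : ℕ) (x : TorWord →₀ R) :
    mulL k x pt = 0 := Finsupp.mapDomain_of_notMem_range x _ (by rintro ⟨_, h⟩; cases h)

@[simp] theorem tauL_apply_pt (k : ℕ) (x : TorWord →₀ R) :
    tauL k x pt = 0 := Finsupp.mapDomain_of_notMem_range x _ (by rintro ⟨_, h⟩; cases h)

variable (u : ℕ → R)

/-- `phi` on basis words. -/
noncomputable def phiW : TorWord → (TorWord →₀ R)
  | pt => 0
  | mul k w => Finsupp.single w (u k)
  | tau _ _ => 0

/-- The chain map lifting the inclusion `I ^ (s + 1) → I ^ s`. -/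
noncomputable def phi : (TorWord →₀ R) →ₗ[R] (TorWord →₀ R) :=
  Finsupp.linearCombination R (phiW u)

/-- `d` on basis words. -/
noncomputable def dW : TorWord → (TorWord →₀ R)
  | pt => 0
  | mul k w => mulL k (dW w)
  | tau k w => mulL k (phiW u w) - Finsupp.single w (u k) - tauL k (dW w)

/-- The differential. -/
noncomputable def d : (TorWord →₀ R) →ₗ[R] (TorWord →₀ R) :=
  Finsupp.linearCombination R (dW u)

/-- `eps` on basis words. -/
def epsW : TorWord → R
  | pt => 1
  | mul k w => u k * epsW w
  | tau _ _ => 0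

/-- The augmentation. -/
noncomputable def eps : (TorWord →₀ R) →ₗ[R] R :=
  Finsupp.linearCombination R (epsW u)

@[simp] theorem phi_mulL (k : ℕ) (x : TorWord →₀ R) : phi u (mulL k x) = u k • x := by
  induction x using Finsupp.induction_linear with
  | zero => simp
  | add x y hx hy => simp [hx, hy]
  | single w r => simp [phi, phiW, mul_comm]

@[simp] theorem phi_tauL (k : ℕ) (x : TorWord →₀ R) : phi u (tauL k x) = 0 := by
  induction x using Finsupp.induction_linear with
  | zero => simp
  | add x y hx hy => simp [hx, hy]
  | single w r => simp [phi, phiW]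

@[simp] theorem d_mulL (k : ℕ) (x : TorWord →₀ R) : d u (mulL k x) = mulL k (d u x) := by
  induction x using Finsupp.induction_linear with
  | zero => simp
  | add x y hx hy => simp [hx, hy]
  | single w r => simp [d, dW]

@[simp] theorem d_tauL (k : ℕ) (x : TorWord →₀ R) :
    d u (tauL k x) = mulL k (phi u x) - u k • x - tauL k (d u x) := by
  induction x using Finsupp.induction_linear with
  | zero => simp
  | add x y hx hy => simp only [map_add, hx, hy, smul_add]; abel
  | single w r => simp [d, dW, phi, smul_sub, mul_comm]

@[simp] theorem eps_mulL (k : ℕ) (x : TorWord →₀ R) : eps u (mulL k x) = u k * eps u x := by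
  induction x using Finsupp.induction_linear with
  | zero => simp
  | add x y hx hy => simp [hx, hy, mul_add]
  | single w r => simp [eps, epsW, mul_left_comm]

@[simp] theorem eps_tauL (k : ℕ) (x : TorWord →₀ R) : eps u (tauL k x) = 0 := by
  induction x using Finsupp.induction_linear with
  | zero => simp
  | add x y hx hy => simp [hx, hy]
  | single w r => simp [eps, epsW]

theorem d_single (w : TorWord) (r : R) : d u (Finsupp.single w r) = r • dW u w := by simp [d]

theorem phi_single (w : TorWord) (r : R) : phi u (Finsupp.single w r) = r • phiW u w := by
  simp [phi]

theorem eps_single (w : TorWord) (r : R) : eps u (Finsupp.single w r) = r * epsW u w := by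
  simp [eps]

/-- On a `tau k` word, `phi` of the differential vanishes because the two terms u_k • `phi` x
cancel. -/
theorem phi_d (x : TorWord →₀ R) : phi u (d u x) = d u (phi u x) := by
  induction x using Finsupp.induction_linear with
  | zero => simp
  | add x y hx hy => simp [hx, hy]
  | single w r =>
    cases w with
    | pt => simp [d_single, phi_single, dW, phiW]
    | mul k w => simp only [← mulL_single, phi_mulL, d_mulL, map_smul]
    | tau k w =>
      simp only [← tauL_single, phi_tauL, d_tauL, map_sub, phi_mulL, map_smul, sub_self, map_zero]

theorem d_d (x : TorWord →₀ R) : d u (d u x) = 0 := by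
  induction x using Finsupp.induction_linear with
  | zero => simp
  | add x y hx hy => simp [hx, hy]
  | single w r =>
    induction w with
    | pt => simp [d_single, dW]
    | mul k w ih => simp only [← mulL_single, d_mulL, ih, map_zero]
    | tau k w ih =>
      simp only [← tauL_single, d_tauL, map_sub, d_mulL, ih, phi_d, map_zero, map_smul]
      abel

variable (R) in
/-- The degree `n` part of the resolution of `(u 0, …, u (k - 1)) ^ s`. -/
def F (k s n : ℕ) : Submodule R (TorWord →₀ R) := Finsupp.supported R R {w | Adm k s n w}

variable {u}

theorem single_mem_F {k s n : ℕ} {w : TorWord} (h : Adm k s n w) (r : R) :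
    Finsupp.single w r ∈ F R k s n := Finsupp.single_mem_supported R r h

theorem F_eq_span (k s n : ℕ) :
    F R k s n = Submodule.span R ((fun w => Finsupp.single w (1 : R)) '' {w | Adm k s n w}) :=
  Finsupp.supported_eq_span_single R _

theorem apply_eq_zero_of_mem_F {k s n : ℕ} {x : TorWord →₀ R} (h : x ∈ F R k s n) {w : TorWord}
    (hw : ¬ Adm k s n w) : x w = 0 := by
  by_contra h0
  exact hw (h (Finsupp.mem_support_iff.2 h0))

theorem mem_F_of {k s n : ℕ} {x : TorWord →₀ R} (h : ∀ w, ¬ Adm k s n w → x w = 0) :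
    x ∈ F R k s n := fun w hw => by
  by_contra h0
  exact Finsupp.mem_support_iff.1 hw (h w h0)

theorem map_mem_of_mem_F {M : Type*} [AddCommGroup M] [Module R M] {k s n : ℕ}
    (f : (TorWord →₀ R) →ₗ[R] M) (N : Submodule R M)
    (h : ∀ w, Adm k s n w → f (Finsupp.single w 1) ∈ N) {x : TorWord →₀ R} (hx : x ∈ F R k s n) :
    f x ∈ N := by
  have : F R k s n ≤ N.comap f := by
    rw [F_eq_span, Submodule.span_le]
    rintro _ ⟨w, hw, rfl⟩
    exact h w hw
  exact this hx

theorem F_mono {k l : ℕ} (h : k ≤ l) (s n : ℕ) : F R k s n ≤ F R l s n :=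
  Finsupp.supported_mono fun _ hw => hw.mono h

theorem mulL_mem {j k s n : ℕ} (h : j < k) {x : TorWord →₀ R} (hx : x ∈ F R (j + 1) s n) :
    mulL j x ∈ F R k (s + 1) n :=
  map_mem_of_mem_F (mulL j) _ (fun w hw => by simpa using single_mem_F (.mul h hw) 1) hx

theorem tauL_mem {j k s n : ℕ} (h : j < k) {x : TorWord →₀ R} (hx : x ∈ F R j (s + 1) n) :
    tauL j x ∈ F R k (s + 1) (n + 1) :=
  map_mem_of_mem_F (tauL j) _ (fun w hw => by simpa using single_mem_F (.tau h hw) 1) hx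

/-- The ideal generated by `u 0, …, u (k - 1)`. -/
def J (u : ℕ → R) (k : ℕ) : Ideal R := Ideal.span (u '' Set.Iio k)

theorem J_mono {k l : ℕ} (h : k ≤ l) : J u k ≤ J u l :=
  Ideal.span_mono (Set.image_mono (Set.Iio_subset_Iio h))

theorem mem_J {j k : ℕ} (h : j < k) : u j ∈ J u k := Ideal.subset_span ⟨j, h, rfl⟩

theorem J_zero : J u 0 = ⊥ := by simp [J]

theorem J_succ (k : ℕ) : J u (k + 1) = J u k ⊔ Ideal.span {u k} := by
  have : Set.Iio (k + 1) = Set.Iio k ∪ {k} := by ext; simp [le_iff_lt_or_eq]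
  rw [J, this, Set.image_union, Ideal.span_union, Set.image_singleton, J]

theorem phi_mem_smul {k s n : ℕ} {x : TorWord →₀ R} (hx : x ∈ F R k (s + 1) n) :
    phi u x ∈ J u k • F R k s n := by
  refine map_mem_of_mem_F (phi u) _ (fun w hw => ?_) hx
  rw [phi_single, one_smul]
  cases hw with
  | mul h hw =>
    rw [phiW, ← mul_one (u _), ← smul_eq_mul, ← Finsupp.smul_single]
    exact Submodule.smul_mem_smul (mem_J h) (F_mono h _ _ (single_mem_F hw 1))
  | tau h hw => exact zero_mem _

theorem phi_mem {k s n : ℕ} {x : TorWord →₀ R} (hx : x ∈ F R k (s + 1) n) :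
    phi u x ∈ F R k s n := Submodule.smul_le_right (phi_mem_smul hx)

theorem map_mem_smul {M N : Type*} [AddCommGroup M] [Module R M] [AddCommGroup N] [Module R N]
    (f : M →ₗ[R] N) {A B : Ideal R} (hAB : A ≤ B) {P : Submodule R M} {Q : Submodule R N}
    (h : ∀ x ∈ P, f x ∈ Q) {x : M} (hx : x ∈ A • P) : f x ∈ B • Q := by
  have : (A • P).map f ≤ B • Q := by
    rw [Submodule.map_smul'']
    exact Submodule.smul_mono hAB (Submodule.map_le_iff_le_comap.2 h)
  exact this ⟨x, hx, rfl⟩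

theorem dW_eq_zero {k s : ℕ} {w : TorWord} (hw : Adm k s 0 w) : dW u w = 0 := by
  induction w generalizing k s with
  | pt => rfl
  | mul j w ih =>
    cases hw with
    | mul h hw => rw [dW, ih hw, map_zero]
  | tau => nomatch hw

/-- Minimality: each non-recursive term of the differential carries a coefficient u_j, and prefixing
letters preserves this. -/
theorem dW_mem_smul {k s n : ℕ} {w : TorWord} (hw : Adm k s (n + 1) w) :
    dW u w ∈ J u k • F R k s n := by
  induction w generalizing k s n with
  | pt => cases hw
  | mul j w ih =>
    cases hw with
    | mul h hw => exact map_mem_smul (mulL j) (J_mono h) (fun _ => mulL_mem h) (ih hw)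
  | tau j w ih =>
    cases hw with
    | @tau _ _ s n _ h hw =>
      rw [dW]
      refine sub_mem (sub_mem ?_ ?_) ?_
      · have := phi_mem_smul (u := u) (single_mem_F hw 1)
        rw [phi_single, one_smul] at this
        exact map_mem_smul (P := F R j s n) (mulL j) (J_mono h.le)
          (fun x hx => mulL_mem h (F_mono (Nat.le_succ j) _ _ hx)) this
      · rw [← mul_one (u _), ← smul_eq_mul, ← Finsupp.smul_single]
        exact Submodule.smul_mem_smul (mem_J h) (F_mono h.le _ _ (single_mem_F hw 1))
      · cases n with
        | zero => 
          rw [dW_eq_zero hw, map_zero]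
          exact zero_mem _
        | succ n =>
          exact map_mem_smul (tauL j) (J_mono h.le) (fun _ => tauL_mem h) (ih hw)

theorem d_mem_smul {k s n : ℕ} {x : TorWord →₀ R} (hx : x ∈ F R k s (n + 1)) :
    d u x ∈ J u k • F R k s n := 
  map_mem_of_mem_F (d u) _ (fun w hw => by rw [d_single, one_smul]; exact dW_mem_smul hw) hx

theorem d_mem {k s n : ℕ} {x : TorWord →₀ R} (hx : x ∈ F R k s (n + 1)) :
    d u x ∈ F R k s n := Submodule.smul_le_right (d_mem_smul hx)

end Maps
end TorWord

namespace TorWord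

/-! ### Exactness for finitely many generators. -/

section Exactness

variable {R : Type u} [CommRing R] {u : ℕ → R}

theorem d_eq_zero {k s : ℕ} {x : TorWord →₀ R} (hx : x ∈ F R k s 0) : d u x = 0 :=
  (Submodule.mem_bot R).1 <| map_mem_of_mem_F (d u) ⊥
    (fun w hw => by rw [d_single, dW_eq_zero hw, smul_zero]; exact zero_mem _) hx

theorem epsW_mem {k s n : ℕ} {w : TorWord} (hw : Adm k s n w) : epsW u w ∈ J u k ^ s := by
  induction hw with
  | pt k => simp
  | mul h _ ih =>
    rw [epsW, pow_succ']
    exact Ideal.mul_mem_mul (mem_J h) (Ideal.pow_right_mono (J_mono h) _ ih)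
  | tau => exact zero_mem _

theorem eps_mem {k s n : ℕ} {x : TorWord →₀ R} (hx : x ∈ F R k s n) : eps u x ∈ J u k ^ s :=
  map_mem_of_mem_F (eps u) (J u k ^ s)
    (fun w hw => by rw [eps_single, one_mul]; exact epsW_mem hw) hx

theorem J_succ_pow_le (k s : ℕ) :
    J u (k + 1) ^ (s + 1) ≤ J u k ^ (s + 1) ⊔ Ideal.span {u k} * J u (k + 1) ^ s := by
  induction s with
  | zero => simp [J_succ]
  | succ s ih =>
    calc J u (k + 1) ^ (s + 1 + 1) = J u (k + 1) ^ (s + 1) * J u k ⊔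
          J u (k + 1) ^ (s + 1) * Ideal.span {u k} := by
          rw [pow_succ _ (s + 1)]; nth_rw 2 [J_succ]; rw [Ideal.mul_sup]
      _ ≤ (J u k ^ (s + 1) ⊔ Ideal.span {u k} * J u (k + 1) ^ s) * J u k ⊔
          J u (k + 1) ^ (s + 1) * Ideal.span {u k} := sup_le_sup_right (Ideal.mul_mono_left ih) _
      _ ≤ _ := by
        rw [Ideal.sup_mul, ← pow_succ, mul_assoc]
        refine sup_le (sup_le_sup_left (Ideal.mul_mono_right ?_) _) ?_
        · rw [pow_succ]; exact Ideal.mul_mono_right (J_mono k.le_succ)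
        · rw [mul_comm]; exact le_sup_right

theorem exists_eps_eq (k s : ℕ) {r : R} (hr : r ∈ J u k ^ s) : ∃ x ∈ F R k s 0, eps u x = r := by
  induction k generalizing s r with
  | zero =>
    cases s with
    | zero => exact ⟨_, single_mem_F (.pt 0) r, by simp [eps_single, epsW]⟩
    | succ s =>
      rw [J_zero, Ideal.bot_pow s.succ_ne_zero, Ideal.mem_bot] at hr
      exact ⟨0, zero_mem _, by simp [hr]⟩
  | succ k ihk =>
    induction s generalizing r with
    | zero => exact ⟨_, single_mem_F (.pt _) r, by simp [eps_single, epsW]⟩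
    | succ s ihs =>
      obtain ⟨a, ha, b, hb, rfl⟩ := Submodule.mem_sup.1 (J_succ_pow_le k s hr)
      obtain ⟨c, hc, rfl⟩ := Ideal.mem_span_singleton_mul.1 hb
      obtain ⟨x, hx, rfl⟩ := ihk _ ha
      obtain ⟨y, hy, rfl⟩ := ihs hc
      exact ⟨x + mulL k y, add_mem (F_mono k.le_succ _ _ hx) (mulL_mem k.lt_succ_self hy), by simp⟩

/-- The positive power excludes the word `pt`, where `phi` is 0 but `eps` is 1. -/
theorem eps_phi {k s n : ℕ} {x : TorWord →₀ R} (hx : x ∈ F R k (s + 1) n) :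
    eps u (phi u x) = eps u x := by
  refine sub_eq_zero.1 ((Submodule.mem_bot R).1
    (map_mem_of_mem_F (eps u ∘ₗ phi u - eps u) ⊥ (fun w hw => ?_) hx))
  cases hw with
  | mul h hw => simp [phi_single, phiW, eps_single, epsW]
  | tau h hw => simp [phi_single, phiW, eps_single, epsW]

theorem eps_d {k s n : ℕ} {x : TorWord →₀ R} (hx : x ∈ F R k s (n + 1)) : eps u (d u x) = 0 := by
  refine (Submodule.mem_bot R).1 (map_mem_of_mem_F (eps u ∘ₗ d u) ⊥ (fun w hw => ?_) hx)
  simp only [LinearMap.comp_apply, Submodule.mem_bot]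
  clear hx x
  induction w generalizing k s n with
  | pt => nomatch hw
  | mul j w ih =>
    cases hw with
    | mul h hw => rw [← mulL_single, d_mulL, eps_mulL, ih hw, mul_zero]
  | tau j w ih =>
    cases hw with
    | tau h hw =>
      rw [← tauL_single, d_tauL, map_sub, map_sub, eps_tauL, eps_mulL, eps_phi (single_mem_F hw 1),
        map_smul, smul_eq_mul, sub_self, sub_zero]

/-- Sorting words by whether they start with `mul k`, `tau k` or a smaller index gives the cone
decomposition. The summand c has degree n - 1, hence the two clauses replacing truncated
subtraction. -/
theorem exists_decomp {k s n : ℕ} {z : TorWord →₀ R} (hz : z ∈ F R (k + 1) (s + 1) n) :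
    ∃ a ∈ F R k (s + 1) n, ∃ b ∈ F R (k + 1) s n, ∃ c : TorWord →₀ R,
      (∀ m, n = m + 1 → c ∈ F R k (s + 1) m) ∧ (n = 0 → c = 0) ∧
      z = a + mulL k b + tauL k c := by
  refine ⟨z - mulL k (mulP k z) - tauL k (tauP k z), mem_F_of fun w hw => ?_,
    mulP k z, mem_F_of fun w hw => ?_, tauP k z, ?_, ?_, by abel⟩
  · cases w with
    | pt => simpa using apply_eq_zero_of_mem_F hz (by rintro ⟨⟩)
    | mul j w =>
      by_cases hj : j = k
      · subst hj; simp
      · have h1 : z (mul j w) = 0 := apply_eq_zero_of_mem_F hz fun h => hw <| by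
          cases h with
          | mul h h' => exact .mul (by omega) h'
        have h2 : mulL k (mulP k z) (mul j w) = 0 := Finsupp.mapDomain_of_notMem_range _ _ <| by
          rintro ⟨_, h⟩; cases h; exact hj rfl
        simp [h1, h2]
    | tau j w =>
      by_cases hj : j = k
      · subst hj; simp
      · have h1 : z (tau j w) = 0 := apply_eq_zero_of_mem_F hz fun h => hw <| by
          cases h with
          | tau h h' => exact .tau (by omega) h'
        have h2 : tauL k (tauP k z) (tau j w) = 0 := Finsupp.mapDomain_of_notMem_range _ _ <| by
          rintro ⟨_, h⟩; cases h; exact hj rfl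
        simp [h1, h2]
  · exact apply_eq_zero_of_mem_F hz fun h => hw <| by cases h; assumption
  · rintro m rfl
    exact mem_F_of fun w hw => apply_eq_zero_of_mem_F hz fun h => hw <| by cases h; assumption
  · rintro rfl
    ext w
    exact apply_eq_zero_of_mem_F hz fun h => nomatch h

theorem mulP_eq_zero {k s n : ℕ} {x : TorWord →₀ R} (hx : x ∈ F R k s n) : mulP k x = 0 := by
  ext w
  refine apply_eq_zero_of_mem_F hx fun h => ?_
  cases h with
  | mul h _ => exact lt_irrefl _ h

theorem tauP_eq_zero {k s n : ℕ} {x : TorWord →₀ R} (hx : x ∈ F R k s n) : tauP k x = 0 := by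
  ext w
  refine apply_eq_zero_of_mem_F hx fun h => ?_
  cases h with
  | tau h _ => exact lt_irrefl _ h

theorem decomp_eq_zero {k s n : ℕ} {a b c : TorWord →₀ R} (ha : a ∈ F R k s n)
    (h : a + mulL k b + tauL k c = 0) : a = 0 ∧ b = 0 ∧ c = 0 := by
  have hb : b = 0 := by
    have h1 := congrArg (mulP k) h
    rw [map_add, map_add, mulP_eq_zero ha, map_zero, zero_add] at h1
    ext w
    simpa using DFunLike.congr_fun h1 w
  have hc : c = 0 := by
    have h1 := congrArg (tauP k) h
    rw [map_add, map_add, tauP_eq_zero ha, map_zero, zero_add] at h1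
    ext w
    simpa using DFunLike.congr_fun h1 w
  subst hb hc
  simpa using h

/-- Exactness in all positive degrees of the resolutions of the powers of `J u k`, including
exactness at the augmentation. -/
def IsExact (u : ℕ → R) (k : ℕ) : Prop :=
  ∀ s n : ℕ, ∀ z ∈ F R k s n, d u z = 0 → (n = 0 → eps u z = 0) → ∃ y ∈ F R k s (n + 1), d u y = z

theorem mem_of_mem_smul_F {I : Ideal R} {k s n : ℕ} {x : TorWord →₀ R} (hx : x ∈ I • F R k s n)
    (w : TorWord) : x w ∈ I := by
  refine Submodule.smul_induction_on hx (fun r hr y _ => ?_) (fun y z hy hz => ?_)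
  · exact I.mul_mem_right _ hr
  · exact I.add_mem hy hz

/-- Since words form a basis, membership in I • F can be tested on coefficients. -/
theorem mem_smul_F {I : Ideal R} {k s n : ℕ} {x : TorWord →₀ R} (hx : x ∈ F R k s n)
    (h : ∀ w, x w ∈ I) : x ∈ I • F R k s n := by
  rw [← Finsupp.sum_single x]
  refine Submodule.sum_mem _ fun w hw => ?_
  rw [← mul_one (x w), ← smul_eq_mul, ← Finsupp.smul_single]
  exact Submodule.smul_mem_smul (h w) (single_mem_F (hx hw) 1)

/-- Minimality turns divisibility in J^s into divisibility of coefficients: if z b ∈ J^{s+1}, any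
lift f of b has z f ∈ J • F, so the case of J itself applies to each coefficient of f. -/
theorem IsExact.mem_pow_of_mul_mem {k : ℕ} (hk : IsExact u k) {z : R}
    (hz : ∀ b, z * b ∈ J u k → b ∈ J u k) (s : ℕ) {b : R} (hb : z * b ∈ J u k ^ s) :
    b ∈ J u k ^ s := by
  induction s with
  | zero => simp
  | succ s ih =>
    obtain ⟨f, hf, rfl⟩ := exists_eps_eq k s (ih (Ideal.pow_le_pow_right s.le_succ hb))
    obtain ⟨g, hg, hgb⟩ : ∃ g ∈ J u k • F R k s 0, eps u g = z * eps u f := by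
      have : J u k ^ (s + 1) ≤ (J u k • F R k s 0).map (eps u) := by
        rw [Submodule.map_smul'', pow_succ', ← smul_eq_mul]
        refine Submodule.smul_mono le_rfl fun r hr => ?_
        exact exists_eps_eq k s hr
      exact this hb
    have hg' := Submodule.smul_le_right hg
    -- z f and g have the same augmentation, so they differ by a boundary, which lies in J • F by
    -- minimality.
    obtain ⟨y, hy, hyd⟩ := hk s 0 (z • f - g) (sub_mem (Submodule.smul_mem _ _ hf) hg')
      (by rw [map_sub, map_smul, d_eq_zero hf, d_eq_zero hg', smul_zero, sub_zero])
      (fun _ => by simp [hgb])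
    have hzf : z • f ∈ J u k • F R k s 0 := by
      have := add_mem (d_mem_smul hy) hg
      rwa [hyd, sub_add_cancel] at this
    have hf' : f ∈ J u k • F R k s 0 :=
      mem_smul_F hf fun w => hz _ (mem_of_mem_smul_F hzf w)
    have := map_mem_smul (eps u) le_rfl (fun x => eps_mem) hf'
    rwa [pow_succ', ← smul_eq_mul]

/-- With no generators the only admissible word is `pt`, in power and degree 0, where `eps` is
injective. -/
theorem isExact_zero : IsExact u 0 := by
  intro s n z hz _ h0
  refine ⟨0, zero_mem _, ?_⟩
  rw [map_zero]
  ext w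
  symm
  by_cases hw : Adm 0 s n w
  · cases hw with
    | pt =>
      have : z = Finsupp.single pt (z pt) := by
        ext w
        by_cases hw : w = pt
        · simp [hw]
        · rw [Finsupp.single_eq_of_ne hw]
          exact apply_eq_zero_of_mem_F hz fun h => by cases h; exact hw rfl
      have h1 := h0 rfl
      rw [this, eps_single, epsW, mul_one] at h1
      simpa using h1
    | mul h => exact absurd h (Nat.not_lt_zero _)
    | tau h => exact absurd h (Nat.not_lt_zero _)
  · exact apply_eq_zero_of_mem_F hz hw

theorem IsExact.succ {k : ℕ} (hk : IsExact u k) (hz : ∀ b, u k * b ∈ J u k → b ∈ J u k) :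
    IsExact u (k + 1) := by
  intro s
  induction s with
  | zero =>
    intro n z hz hd h0
    obtain ⟨y, hy, h⟩ := hk 0 n z (fun w hw => by
      have := hz hw
      cases this with | pt => exact .pt k) hd h0
    exact ⟨y, F_mono k.le_succ _ _ hy, h⟩
  | succ s ih =>
    intro n z hzF hd h0
    obtain ⟨a, ha, b, hb, c, hc, hc0, rfl⟩ := exists_decomp hzF
    -- Adding the boundary of `tauL k c'` removes the `tau k` part of the cycle. What remains splits
    -- into a cycle at stage k and a cycle for the lower power at stage k + 1.
    obtain ⟨c', hc', hdc, hda, hdb, hea, heb⟩ : ∃ c' ∈ F R k (s + 1) n, d u c' = c ∧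
        d u (a - u k • c') = 0 ∧ d u (b + phi u c') = 0 ∧
        (n = 0 → eps u (a - u k • c') = 0) ∧ (n = 0 → eps u (b + phi u c') = 0) := by
      cases n with
      | zero =>
        obtain rfl := hc0 rfl
        have he := h0 rfl
        simp only [map_add, map_zero, add_zero, eps_mulL] at he
        -- Exactness in the middle of the short exact sequence: u_k • `eps u b` lies in J_k^{s+1},
        -- hence so does `eps u b`.
        obtain ⟨c', hc', hec⟩ : ∃ c' ∈ F R k (s + 1) 0, eps u c' = -eps u b := by
          refine exists_eps_eq k _ (neg_mem (hk.mem_pow_of_mul_mem hz (s + 1) ?_))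
          rw [← neg_eq_of_add_eq_zero_right he]
          exact neg_mem (eps_mem ha)
        refine ⟨c', hc', d_eq_zero hc', ?_, ?_, fun _ => ?_, fun _ => ?_⟩
        · rw [map_sub, map_smul, d_eq_zero ha, d_eq_zero hc', smul_zero, sub_zero]
        · rw [map_add, d_eq_zero hb, d_eq_zero (phi_mem hc'), add_zero]
        · rw [map_sub, map_smul, hec, smul_neg, sub_neg_eq_add, smul_eq_mul, he]
        · rw [map_add, eps_phi hc', hec, add_neg_cancel]
      | succ m =>
        have hc := hc m rfl
        -- The vanishing boundary is read off on the three summands.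
        obtain ⟨h1, h2, h3⟩ := decomp_eq_zero (k := k) (a := d u a - u k • c)
          (b := d u b + phi u c) (c := - d u c)
          (sub_mem (d_mem ha) (Submodule.smul_mem _ _ hc)) (by
            rw [← hd]; simp only [map_add, d_mulL, d_tauL, map_neg]; abel)
        obtain ⟨c', hc', hdc⟩ := hk (s + 1) m c hc (neg_eq_zero.1 h3) (by
          -- When c has degree 0 its augmentation must vanish too; this follows by applying `eps` to
          -- the `mul k` component.
          rintro rfl
          have := congrArg (eps u) h2
          rwa [map_add, eps_d hb, eps_phi hc, zero_add, map_zero] at this)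
        refine ⟨c', hc', hdc, ?_, ?_, nofun, nofun⟩
        · rw [map_sub, map_smul, hdc, h1]
        · rw [map_add, ← phi_d, hdc, h2]
    obtain ⟨x, hx, hdx⟩ := hk (s + 1) n _ (sub_mem ha (Submodule.smul_mem _ _ hc')) hda hea
    obtain ⟨y, hy, hdy⟩ := ih n _ (add_mem hb (F_mono k.le_succ _ _ (phi_mem hc'))) hdb heb
    refine ⟨x + mulL k y - tauL k c', sub_mem (add_mem (F_mono k.le_succ _ _ hx)
      (mulL_mem k.lt_succ_self hy)) (tauL_mem k.lt_succ_self hc'), ?_⟩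
    simp only [map_add, map_sub, d_mulL, d_tauL, hdx, hdy, hdc]
    abel

theorem isExact_of_regular (k : ℕ) (h : ∀ j < k, ∀ b, u j * b ∈ J u j → b ∈ J u j) :
    IsExact u k := by
  induction k with
  | zero => exact isExact_zero
  | succ k ih => exact (ih fun j hj => h j (hj.trans k.lt_succ_self)).succ (h k k.lt_succ_self)

end Exactness
end TorWord

theorem HomologicalComplex.homologyFunctor_map_smul {R : Type*} [Semiring R] {C : Type*}
    [Category* C] [Preadditive C] [CategoryWithHomology C] [Linear R C] {ι : Type*}
    {c : ComplexShape ι} {X Y : HomologicalComplex C c} (f : X ⟶ Y) (r : R) (i : ι) :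
    (HomologicalComplex.homologyFunctor C c i).map (r • f) =
      r • (HomologicalComplex.homologyFunctor C c i).map f :=
  ShortComplex.homologyMap_smul ((HomologicalComplex.shortComplexFunctor C c i).map f) r

/-! ### Tor from a minimal free resolution. -/

section MinimalResolution

variable {R : Type u} [CommRing R]

/-- Needed to compare the functorial A-action with the R-action, on the level of a projective
resolution. -/
theorem algTorMul_algebraMap {A : Type u} [CommRing A] [Algebra R A] {M : Type u}
    [AddCommGroup M] [Module R M] (n : ℕ) (r : R) :
    algTorMul R A M n (algebraMap R A r) = r • 𝟙 _ := by
  have h : ModuleCat.ofHom (LinearMap.mulLeft R (algebraMap R A r)) =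
      r • 𝟙 (ModuleCat.of R A) := by
    ext x; exact (Algebra.smul_def r x).symm
  let P := projectiveResolution (ModuleCat.of R M)
  have key := fun f : ModuleCat.of R A ⟶ ModuleCat.of R A =>
    P.leftDerived_app_eq ((MonoidalCategory.tensoringLeft (ModuleCat.{u} R)).map f) n
  unfold algTorMul
  rw [h]
  simp only [Tor_map]
  rw [key]
  have e : (NatTrans.mapHomologicalComplex
        ((MonoidalCategory.tensoringLeft (ModuleCat.{u} R)).map (r • 𝟙 (ModuleCat.of R A)))
        (ComplexShape.down ℕ)).app P.complex = r • 𝟙 _ := by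
    ext1 i
    simp
    rfl
  rw [e, HomologicalComplex.homologyFunctor_map_smul, CategoryTheory.Functor.map_id,
    Linear.smul_comp, Linear.comp_smul, Category.id_comp, Iso.hom_inv_id]
  rfl

/-- The chain complex given by composable maps with zero composites. -/
noncomputable def complexOf (P : ℕ → ModuleCat.{u} R) (d : ∀ n, P (n + 1) ⟶ P n)
    (h : ∀ n, d (n + 1) ≫ d n = 0) : ChainComplex (ModuleCat.{u} R) ℕ := ChainComplex.of P d h

theorem complexOf_d (P : ℕ → ModuleCat.{u} R) (d : ∀ n, P (n + 1) ⟶ P n)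
    (h : ∀ n, d (n + 1) ≫ d n = 0) (n : ℕ) : (complexOf P d h).d (n + 1) n = d n :=
  ChainComplex.of_d P d n

/-- The projective resolution given by an exact sequence of projective modules. -/
noncomputable def resolutionOfExact {M : ModuleCat.{u} R} (P : ℕ → ModuleCat.{u} R)
    (hP : ∀ n, Projective (P n)) (d : ∀ n, P (n + 1) ⟶ P n) (hdd : ∀ n, d (n + 1) ≫ d n = 0)
    (ε : P 0 ⟶ M)
    (hε : Function.Surjective ε) (h0 : Function.Exact (d 0) ε)
    (h : ∀ n, Function.Exact (d (n + 1)) (d n)) : ProjectiveResolution M where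
  complex := complexOf P d hdd
  projective := hP
  π := (ChainComplex.toSingle₀Equiv _ _).symm ⟨ε, by
    rw [complexOf_d]
    ext x; exact h0.apply_apply_eq_zero x⟩
  quasiIso := ⟨fun n => by
    cases n with
    | zero =>
      rw [ChainComplex.quasiIsoAt₀_iff, ShortComplex.quasiIso_iff_of_zeros'] <;> try rfl
      constructor
      · rw [ShortComplex.ShortExact.moduleCat_exact_iff_function_exact]
        change Function.Exact ((complexOf P d hdd).d (0 + 1) 0) ε
        rw [complexOf_d]
        exact h0
      · exact (ModuleCat.epi_iff_surjective _).2 hε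
    | succ n =>
      rw [quasiIsoAt_iff_exactAt']
      · rw [HomologicalComplex.exactAt_iff' _ (n + 2) (n + 1) n (by simp) (by simp),
          ShortComplex.ShortExact.moduleCat_exact_iff_function_exact]
        change Function.Exact ((complexOf P d hdd).d (n + 1 + 1) (n + 1))
          ((complexOf P d hdd).d (n + 1) n)
        rw [complexOf_d, complexOf_d]
        exact h n
      · apply ChainComplex.exactAt_succ_single_obj⟩

theorem lTensor_eq_zero_of_mem_smul (I : Ideal R) {P Q : Type u} [AddCommGroup P] [Module R P]
    [AddCommGroup Q] [Module R Q] (d : P →ₗ[R] Q) (hd : ∀ x, d x ∈ I • (⊤ : Submodule R Q)) :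
    d.lTensor (R ⧸ I) = 0 := by
  refine TensorProduct.ext' fun a x => ?_
  rw [LinearMap.lTensor_tmul, LinearMap.zero_apply]
  refine Submodule.smul_induction_on (hd x) (fun r hr y _ => ?_) (fun y z hy hz => ?_)
  · rw [← TensorProduct.smul_tmul, Algebra.smul_def, Ideal.Quotient.algebraMap_eq,
      Ideal.Quotient.eq_zero_iff_mem.2 hr, zero_mul, TensorProduct.zero_tmul]
  · rw [TensorProduct.tmul_add, hy, hz, add_zero]

theorem free_algTor_of_minimal (I : Ideal R) (M : Type u) [AddCommGroup M] [Module R M]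
    (P : ℕ → ModuleCat.{u} R) (hP : ∀ n, Module.Free R (P n)) (d : ∀ n, P (n + 1) ⟶ P n)
    (ε : P 0 ⟶ ModuleCat.of R M)
    (hε : Function.Surjective ε) (h0 : Function.Exact (d 0) ε)
    (h : ∀ n, Function.Exact (d (n + 1)) (d n))
    (hd : ∀ n x, (d n).hom x ∈ I • (⊤ : Submodule R (P n))) (n : ℕ) :
    Module.Free (R ⧸ I) (AlgTor R (R ⧸ I) M n) := by
  have hP' : ∀ n, Projective (P n) := fun n =>
    ModuleCat.projective_of_free (Module.Free.chooseBasis R (P n))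
  have hdd : ∀ n, d (n + 1) ≫ d n = 0 := fun n => by
    ext x; exact (h n).apply_apply_eq_zero x
  let Q := resolutionOfExact P hP' d hdd ε hε h0 h
  let T := (MonoidalCategory.tensoringLeft (ModuleCat.{u} R)).obj (ModuleCat.of R (R ⧸ I))
  let K := (T.mapHomologicalComplex (ComplexShape.down ℕ)).obj Q.complex
  have hT : ∀ n, T.map (d n) = 0 := fun n => by
    apply ModuleCat.hom_ext
    exact lTensor_eq_zero_of_mem_smul I (d n).hom (hd n)
  have hK : ∀ i j, K.d i j = 0 := fun i j => by
    by_cases hij : j + 1 = i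
    · subst hij
      change T.map (Q.complex.d (j + 1) j) = 0
      rw [show Q.complex.d (j + 1) j = d j from complexOf_d P d hdd j]
      exact hT j
    · exact K.shape _ _ hij
  let e : AlgTorObj R (R ⧸ I) M n ≅ T.obj (P n) :=
    Q.isoLeftDerivedObj T n ≪≫
      (ShortComplex.LeftHomologyData.ofZeros (K.sc n) (hK _ _) (hK _ _)).homologyIso
  let f : AlgTorObj R (R ⧸ I) M n ≃ₗ[R] TensorProduct R (R ⧸ I) (P n) := e.toLinearEquiv
  -- As R → R/I is surjective and both actions restrict to the R-action, the R-linear isomorphism is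
  -- R/I-linear.
  let g : TensorProduct R (R ⧸ I) (P n) ≃ₗ[R ⧸ I] AlgTor R (R ⧸ I) M n :=
    { f.symm.toAddEquiv with
      map_smul' := fun a x => by
        obtain ⟨r, rfl⟩ := Ideal.Quotient.mk_surjective a
        have h1 : (Ideal.Quotient.mk I r) • x = r • x := algebraMap_smul (R ⧸ I) r x
        rw [h1]
        refine (f.symm.map_smul r x).trans ?_
        exact (congrArg (fun φ : AlgTorObj R (R ⧸ I) M n ⟶ AlgTorObj R (R ⧸ I) M n =>
          φ.hom (f.symm x)) (algTorMul_algebraMap (M := M) (A := R ⧸ I) n r)).symm }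
  exact Module.Free.of_equiv g

end MinimalResolution

namespace TorWord

/-! ### Passage to finitely or infinitely many generators. -/

section Union

variable {R : Type u} [CommRing R]

variable (R) in
/-- The degree `n` part of the resolution of the `s`-th power of the ideal generated by the
`u j` with `j < N`, where `N` may be infinite. -/
def G (N : ℕ∞) (s n : ℕ) : Submodule R (TorWord →₀ R) :=
  Finsupp.supported R R {w | ∃ k : ℕ, (k : ℕ∞) ≤ N ∧ Adm k s n w}

theorem F_le_G {N : ℕ∞} {k : ℕ} (hk : (k : ℕ∞) ≤ N) (s n : ℕ) : F R k s n ≤ G R N s n :=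
  Finsupp.supported_mono fun _ hw => ⟨k, hk, hw⟩

theorem exists_mem_F {N : ℕ∞} {s n : ℕ} {x : TorWord →₀ R} (hx : x ∈ G R N s n) :
    ∃ k : ℕ, (k : ℕ∞) ≤ N ∧ x ∈ F R k s n := by
  rw [G, Finsupp.supported_eq_span_single] at hx
  induction hx using Submodule.span_induction with
  | mem x hx =>
    obtain ⟨w, ⟨k, hk, hw⟩, rfl⟩ := hx
    exact ⟨k, hk, single_mem_F hw 1⟩
  | zero => exact ⟨0, by simp, zero_mem _⟩
  | add x y _ _ hx hy =>
    obtain ⟨k, hk, hx⟩ := hx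
    obtain ⟨l, hl, hy⟩ := hy
    refine ⟨max k l, ?_, add_mem (F_mono (le_max_left _ _) _ _ hx)
      (F_mono (le_max_right _ _) _ _ hy)⟩
    rcases max_choice k l with h | h <;> rwa [h]
  | smul r x _ hx =>
    obtain ⟨k, hk, hx⟩ := hx
    exact ⟨k, hk, Submodule.smul_mem _ _ hx⟩

/-- The ideal generated by the `u j` with `j < N`. -/
def JU (u : ℕ → R) (N : ℕ∞) : Ideal R := Ideal.span (u '' {j | (j : ℕ∞) < N})

variable {u : ℕ → R} {N : ℕ∞}

theorem J_le_JU {k : ℕ} (hk : (k : ℕ∞) ≤ N) : J u k ≤ JU u N :=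
  Ideal.span_mono (Set.image_mono fun _ hj => (Nat.cast_lt.2 hj).trans_le hk)

theorem exists_mem_J {r : R} (hr : r ∈ JU u N) : ∃ k : ℕ, (k : ℕ∞) ≤ N ∧ r ∈ J u k := by
  induction hr using Submodule.span_induction with
  | mem x hx =>
    obtain ⟨j, hj, rfl⟩ := hx
    exact ⟨j + 1, by rw [Nat.cast_succ]; exact Order.add_one_le_of_lt hj, mem_J j.lt_succ_self⟩
  | zero => exact ⟨0, by simp, zero_mem _⟩
  | add x y _ _ hx hy =>
    obtain ⟨k, hk, hx⟩ := hx
    obtain ⟨l, hl, hy⟩ := hy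
    refine ⟨max k l, ?_, add_mem (J_mono (le_max_left _ _) hx) (J_mono (le_max_right _ _) hy)⟩
    rcases max_choice k l with h | h <;> rwa [h]
  | smul r x _ hx =>
    obtain ⟨k, hk, hx⟩ := hx
    exact ⟨k, hk, Ideal.mul_mem_left _ _ hx⟩

theorem exists_mem_J_pow (s : ℕ) {r : R} (hr : r ∈ JU u N ^ s) :
    ∃ k : ℕ, (k : ℕ∞) ≤ N ∧ r ∈ J u k ^ s := by
  induction s generalizing r with
  | zero => exact ⟨0, by simp, by simp⟩
  | succ s ih =>
    rw [pow_succ] at hr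
    refine Submodule.mul_induction_on hr (fun x hx y hy => ?_) (fun x y hx hy => ?_)
    · obtain ⟨k, hk, hx⟩ := ih hx
      obtain ⟨l, hl, hy⟩ := exists_mem_J hy
      refine ⟨max k l, ?_, ?_⟩
      · rcases max_choice k l with h | h <;> rwa [h]
      · rw [pow_succ]
        exact Ideal.mul_mem_mul (Ideal.pow_right_mono (J_mono (le_max_left _ _)) _ hx)
          (J_mono (le_max_right _ _) hy)
    · obtain ⟨k, hk, hx⟩ := hx
      obtain ⟨l, hl, hy⟩ := hy
      refine ⟨max k l, ?_, add_mem (Ideal.pow_right_mono (J_mono (le_max_left _ _)) _ hx)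
        (Ideal.pow_right_mono (J_mono (le_max_right _ _)) _ hy)⟩
      rcases max_choice k l with h | h <;> rwa [h]

theorem d_mem_smul_G {s n : ℕ} {x : TorWord →₀ R} (hx : x ∈ G R N s (n + 1)) :
    d u x ∈ JU u N • G R N s n := by
  obtain ⟨k, hk, hx⟩ := exists_mem_F hx
  exact Submodule.smul_mono (J_le_JU hk) (F_le_G hk s n) (d_mem_smul hx)

theorem d_mem_G {s n : ℕ} {x : TorWord →₀ R} (hx : x ∈ G R N s (n + 1)) :
    d u x ∈ G R N s n := Submodule.smul_le_right (d_mem_smul_G hx)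

theorem eps_mem_JU {s n : ℕ} {x : TorWord →₀ R} (hx : x ∈ G R N s n) : eps u x ∈ JU u N ^ s := by
  obtain ⟨k, hk, hx⟩ := exists_mem_F hx
  exact Ideal.pow_right_mono (J_le_JU hk) s (eps_mem hx)

instance (N : ℕ∞) (s n : ℕ) : Module.Free R (G R N s n) :=
  Module.Free.of_equiv (Finsupp.supportedEquivFinsupp _).symm

/-- The differential as a map between the graded pieces. -/
noncomputable def dG (u : ℕ → R) (N : ℕ∞) (s n : ℕ) : G R N s (n + 1) →ₗ[R] G R N s n :=
  (d u).restrict fun _ hx => d_mem_G hx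

variable (R) in
/-- The terms of the resolution of the quotient by the `s`-th power of `JU u N`. -/
noncomputable def resolutionObj (N : ℕ∞) (s : ℕ) : ℕ → ModuleCat.{u} R
  | 0 => ModuleCat.of R R
  | n + 1 => ModuleCat.of R (G R N s n)

/-- The maps of the resolution of the quotient by the `s`-th power of `JU u N`. -/
noncomputable def resolutionMap (u : ℕ → R) (N : ℕ∞) (s : ℕ) :
    ∀ n, resolutionObj R N s (n + 1) ⟶ resolutionObj R N s n
  | 0 => ModuleCat.ofHom (eps u ∘ₗ (G R N s 0).subtype)
  | n + 1 => ModuleCat.ofHom (dG u N s n)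

theorem mem_smul_top_of_coe {M : Type*} [AddCommGroup M] [Module R M] {I : Ideal R}
    {P : Submodule R M} {x : P} (hx : (x : M) ∈ I • P) : x ∈ I • (⊤ : Submodule R P) := by
  have : (I • (⊤ : Submodule R P)).map P.subtype = I • P := by
    rw [Submodule.map_smul'', Submodule.map_top, Submodule.range_subtype]
  rw [← this] at hx
  obtain ⟨y, hy, h⟩ := hx
  rwa [← Subtype.ext h]

theorem free_algTor (h : ∀ j : ℕ, (j : ℕ∞) < N → ∀ b, u j * b ∈ J u j → b ∈ J u j)
    {s : ℕ} (hs : 1 ≤ s) (n : ℕ) :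
    Module.Free (R ⧸ JU u N) (AlgTor R (R ⧸ JU u N) (R ⧸ JU u N ^ s) n) := by
  have hex : ∀ k : ℕ, (k : ℕ∞) ≤ N → IsExact u k := fun k hk =>
    isExact_of_regular k fun j hj => h j ((Nat.cast_lt.2 hj).trans_le hk)
  refine free_algTor_of_minimal (JU u N) _ (resolutionObj R N s) ?_ (resolutionMap u N s)
    (ModuleCat.ofHom (Submodule.mkQ (JU u N ^ s))) (Submodule.mkQ_surjective _) ?_ ?_ ?_ n
  · rintro (_ | n)
    · exact inferInstanceAs (Module.Free R R)
    · exact inferInstanceAs (Module.Free R (G R N s n))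
  · intro (r : R)
    refine (Submodule.Quotient.mk_eq_zero (JU u N ^ s)).trans ?_
    change r ∈ JU u N ^ s ↔ ∃ x : G R N s 0, eps u x = r
    constructor
    · intro hr
      obtain ⟨k, hk, hr⟩ := exists_mem_J_pow s hr
      obtain ⟨x, hx, rfl⟩ := exists_eps_eq k s hr
      exact ⟨⟨x, F_le_G hk _ _ hx⟩, rfl⟩
    · rintro ⟨x, rfl⟩
      exact eps_mem_JU x.2
  · rintro (_ | n)
    · rintro ⟨x, hx⟩
      change eps u x = 0 ↔ ∃ y, dG u N s 0 y = ⟨x, hx⟩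
      constructor
      · intro hx0
        obtain ⟨k, hk, hx⟩ := exists_mem_F hx
        obtain ⟨y, hy, hyx⟩ := hex k hk s 0 x hx (d_eq_zero hx) fun _ => hx0
        exact ⟨⟨y, F_le_G hk _ _ hy⟩, Subtype.ext hyx⟩
      · rintro ⟨⟨y, hy⟩, hyx⟩
        obtain rfl := congrArg Subtype.val hyx
        obtain ⟨k, hk, hy⟩ := exists_mem_F hy
        exact eps_d hy
    · rintro ⟨x, hx⟩
      change dG u N s n ⟨x, hx⟩ = 0 ↔ ∃ y, dG u N s (n + 1) y = ⟨x, hx⟩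
      constructor
      · intro hx0
        obtain ⟨k, hk, hx⟩ := exists_mem_F hx
        obtain ⟨y, hy, hyx⟩ := hex k hk s (n + 1) x hx (congrArg Subtype.val hx0) nofun
        exact ⟨⟨y, F_le_G hk _ _ hy⟩, Subtype.ext hyx⟩
      · rintro ⟨⟨y, hy⟩, hyx⟩
        obtain rfl := congrArg Subtype.val hyx
        exact Subtype.ext (d_d u y)
  · rintro (_ | n)
    · rintro ⟨x, hx⟩
      change eps u x ∈ JU u N • (⊤ : Submodule R R)
      rw [smul_eq_mul, Ideal.mul_top]
      -- The augmentation into R is minimal only because I^s ⊆ I, which uses s ≥ 1.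
      exact Ideal.pow_le_self (by omega) (eps_mem_JU hx)
    · rintro ⟨x, hx⟩
      exact mem_smul_top_of_coe (d_mem_smul_G hx)

end Union

/-! ### Translation from weakly regular sequences. -/

section Regular

variable {R : Type u} [CommRing R] {u : ℕ → R}

theorem mem_J_of_isWeaklyRegular {rs : List R} (hrs : RingTheory.Sequence.IsWeaklyRegular R rs)
    {j : ℕ} (hj : j < rs.length) (hJ : Ideal.ofList (rs.take j) = J u j) {b : R}
    (hb : rs[j] * b ∈ J u j) : b ∈ J u j := by
  have h := hrs.regular_mod_prev j hj
  rw [smul_eq_mul, Ideal.mul_top, hJ] at h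
  rw [← Submodule.Quotient.mk_eq_zero]
  apply h
  change rs[j] • Submodule.Quotient.mk b = rs[j] • 0
  rw [smul_zero, ← Submodule.Quotient.mk_smul, Submodule.Quotient.mk_eq_zero]
  exact hb

end Regular

end TorWord

theorem mainTheorem5 {R : Type u} [CommRing R] (I : Ideal R) (hI : IsRegularIdeal I)
    (s : ℕ) (hs : 1 ≤ s) :
    ∀ n : ℕ, Module.Free (R ⧸ I) (AlgTor R (R ⧸ I) (R ⧸ I ^ s) n) := by
  intro n
  rcases hI with ⟨rs, hrs, rfl⟩ | ⟨x, hx, rfl⟩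
  -- The list is extended by zeros to a sequence; only indices below its length are used.
  · have hset : ∀ j : ℕ, j ≤ rs.length →
        {r | r ∈ rs.take j} = (fun i => rs.getD i 0) '' Set.Iio j := by
      intro j hj
      ext r
      simp only [Set.mem_ofPred_eq, List.mem_take_iff_getElem, Set.mem_image, Set.mem_Iio]
      constructor
      · rintro ⟨i, hi, rfl⟩
        exact ⟨i, by omega, List.getD_eq_getElem _ _ _⟩
      · rintro ⟨i, hi, rfl⟩
        exact ⟨i, by omega, (List.getD_eq_getElem _ _ _).symm⟩
    have hI : Ideal.ofList rs = TorWord.JU (fun i => rs.getD i 0) (rs.length : ℕ∞) := by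
      have := hset rs.length le_rfl
      rw [List.take_length] at this
      rw [Ideal.ofList, this, TorWord.JU]
      simp only [Nat.cast_lt]
      rfl
    rw [hI]
    refine TorWord.free_algTor (fun j hj b hb => ?_) hs n
    have hj : j < rs.length := Nat.cast_lt.1 hj
    refine TorWord.mem_J_of_isWeaklyRegular hrs hj (by rw [Ideal.ofList, hset j hj.le]; rfl) ?_
    rwa [List.getD_eq_getElem _ _ hj] at hb
  · have hI : Ideal.span (Set.range x) = TorWord.JU x ⊤ := by
      simp [TorWord.JU]
    rw [hI]
    refine TorWord.free_algTor (fun j _ b hb => ?_) hs n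
    -- The prefix of length j + 1 is the shortest containing the entry with index j.
    refine TorWord.mem_J_of_isWeaklyRegular (hx (j + 1)) (j := j) (by simp) ?_ (by simpa using hb)
    rw [Ideal.ofList, TorWord.J]
    congr 1
    ext r
    simp [← List.map_take, List.take_range]
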